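/- Let $a,b,c,d$ be real numbers with $a,c>0$ and $b,d<0$, and let $(W_n(z))_{n\ge 0}$ be the sequence of polynomials defined by $W_0(z)=1$, $W_1(z)=z$ and $$W_n(z)=(az+b)\,W_{n-1}(z)+(cz+d)\,W_{n-2}(z)\qquad (n\ge 2).$$ Let $x_A=-b/a$ and $x_B=-d/c$ be the zeros of $A(z)=az+b$ and $B(z)=cz+d$. Call a polynomial with real coefficients real-rooted if all of its complex zeros are real. Then $W_n(z)$ is real-rooted for every $n\ge 0$ if and only if $x_A\le x_B$; and $x_A\le x_B$ is equivalent to $ad\le bc$. -/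

import Mathlib

open Polynomial

/-- The sequence of polynomials `W₀ = 1`, `W₁ = z`,
`Wₙ = (a z + b) Wₙ₋₁ + (c z + d) Wₙ₋₂` for `n ≥ 2`. -/
noncomputable def linRecPoly (a b c d : ℝ) : ℕ → ℝ[X]
  | 0 => 1
  | 1 => X
  | n + 2 => (C a * X + C b) * linRecPoly a b c d (n + 1)
      + (C c * X + C d) * linRecPoly a b c d n

/-- A real polynomial is real-rooted if all of its complex zeros are real. -/
def RealRooted (p : ℝ[X]) : Prop :=
  ∀ z : ℂ, aeval z p = 0 → z.im = 0

/-- The zero `x_A = -b/a` of `A(z) = a z + b`. -/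
noncomputable def xA (a b : ℝ) : ℝ := -b / a

/-- The zero `x_B = -d/c` of `B(z) = c z + d`. -/
noncomputable def xB (c d : ℝ) : ℝ := -d / c

/-! If `x_A ≤ x_B`, put `t = z - x_B`. For non-real `z` each ratio `W_{n+1}/W_n` is `αt + β` with `α
> 0`, `β ≥ 0`: the recurrence sends `R` to `A + ct/R`, and `exists_cone_quotient` keeps this in the
cone. Hence no `W_n` vanishes at `z`.

If `x_B < x_A`, then `B > 0` at `x = x_A`, where `W_n` has size `B^(n/2)` because `A = 0`. At `x ±
h` the lower bounds grow like `μ^n` and `ν^n`, with `μν > B(x)`. For one parity of `n` there is no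
zero in `[x - h, x + h]`, so real-rootedness would force the midpoint inequality
`RealRooted.abs_eval_mul_le`, which fails for large `n`. -/

theorem eval_linRecPoly_add_two (a b c d x : ℝ) (n : ℕ) :
    (linRecPoly a b c d (n + 2)).eval x = (a * x + b) * (linRecPoly a b c d (n + 1)).eval x
      + (c * x + d) * (linRecPoly a b c d n).eval x := by
  simp [linRecPoly]

theorem aeval_linRecPoly_add_two (a b c d : ℝ) (z : ℂ) (n : ℕ) :
    aeval z (linRecPoly a b c d (n + 2)) = (a * z + b) * aeval z (linRecPoly a b c d (n + 1))
      + (c * z + d) * aeval z (linRecPoly a b c d n) := by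
  simp [linRecPoly]

/-! ### Sufficiency: an invariant cone for the ratios. -/

/-- If `t` is not real and `R = α t + β` with `α > 0`, `β ≥ 0`, then `t / R` is a nonnegative real
combination of `1` and `t`. -/
theorem exists_cone_quotient {t : ℂ} (ht : t.im ≠ 0) {α β : ℝ} (hα : 0 < α) (hβ : 0 ≤ β) :
    (α * t + β : ℂ) ≠ 0 ∧
      ∃ γ δ : ℝ, 0 ≤ γ ∧ 0 ≤ δ ∧ t = (γ * t + δ : ℂ) * (α * t + β) := by
  have hR : (α * t + β : ℂ) ≠ 0 := by
    intro h
    have := congrArg Complex.im h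
    simp at this
    exact this.elim hα.ne' ht
  -- Multiply `t / (αt + β)` above and below by the conjugate: the numerator becomes `α|t|² + βt`.
  refine ⟨hR, β / Complex.normSq (α * t + β), α * Complex.normSq t / Complex.normSq (α * t + β),
    div_nonneg hβ (Complex.normSq_nonneg _),
    div_nonneg (mul_nonneg hα.le (Complex.normSq_nonneg _)) (Complex.normSq_nonneg _), ?_⟩
  have h1 : ((Complex.normSq (α * t + β) : ℝ) : ℂ)
      = (α * t + β) * (α * (starRingEnd ℂ) t + β) := by
    rw [← Complex.mul_conj]; simp
  have h2 : ((Complex.normSq (α * t + β) : ℝ) : ℂ) ≠ 0 := by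
    simpa using hR
  have h3 : (α * (starRingEnd ℂ) t + β : ℂ) ≠ 0 := fun h => h2 (by rw [h1, h, mul_zero])
  push_cast
  rw [h1, ← Complex.mul_conj t]
  obtain ⟨P, hP⟩ : ∃ P, P = (α * t + β : ℂ) := ⟨_, rfl⟩
  obtain ⟨Q, hQ⟩ : ∃ Q, Q = (α * (starRingEnd ℂ) t + β : ℂ) := ⟨_, rfl⟩
  rw [← hP] at hR
  rw [← hQ] at h3
  rw [← hP, ← hQ]
  field_simp
  linear_combination t * hQ

theorem realRooted_linRecPoly {a b c d : ℝ} (ha : 0 < a) (hc : 0 < c) (hd : d < 0)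
    (h : a * d ≤ b * c) (n : ℕ) : RealRooted (linRecPoly a b c d n) := by
  intro z hz
  by_contra hzim
  set s : ℝ := -d / c with hs
  have hs0 : 0 < s := div_pos (neg_pos.2 hd) hc
  have hcs : c * s = -d := by rw [hs]; field_simp
  have he : 0 ≤ a * s + b := by
    have : 0 ≤ (a * s + b) * c := by nlinarith
    exact nonneg_of_mul_nonneg_left this hc
  set t : ℂ := z - s with htdef
  have hzt : z = t + s := by simp [htdef]
  have ht : t.im ≠ 0 := by simpa [htdef] using hzim
  have key : ∀ n : ℕ, aeval z (linRecPoly a b c d n) ≠ 0 ∧ ∃ α β : ℝ, 0 < α ∧ 0 ≤ β ∧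
      aeval z (linRecPoly a b c d (n + 1)) = (α * t + β : ℂ) * aeval z (linRecPoly a b c d n) := by
    intro n
    induction n with
    | zero =>
      refine ⟨by simp [linRecPoly], 1, s, one_pos, hs0.le, ?_⟩
      simp [linRecPoly, hzt]
    | succ n ih =>
      obtain ⟨hn, α, β, hα, hβ, hrec⟩ := ih
      obtain ⟨hR, γ, δ, hγ, hδ, hq⟩ := exists_cone_quotient ht hα hβ
      refine ⟨by rw [hrec]; exact mul_ne_zero hR hn, a + c * γ, (a * s + b) + c * δ,
        by positivity, by positivity, ?_⟩
      have hcs' : (c * s : ℂ) = -d := by exact_mod_cast hcs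
      have hA : (a * z + b : ℂ) = a * t + (a * s + b) := by rw [hzt]; ring
      have hB : (c * z + d : ℂ) = c * t := by
        rw [hzt]; linear_combination hcs'
      rw [aeval_linRecPoly_add_two, hA, hB, hrec]
      push_cast
      linear_combination (c * aeval z (linRecPoly a b c d n) : ℂ) * hq
  exact (key n).1 hz

/-! ### Necessity: growth against log-concavity at `x_A`. -/

/-- A real-rooted polynomial satisfies a midpoint log-concavity inequality on root-free
intervals. -/
theorem RealRooted.abs_eval_mul_le {p : ℝ[X]} (hp : RealRooted p) {x h : ℝ} (hh : 0 ≤ h)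
    (hfree : ∀ y ∈ Set.Icc (x - h) (x + h), p.eval y ≠ 0) :
    |p.eval (x - h)| * |p.eval (x + h)| ≤ p.eval x ^ 2 := by
  have hp0 : p ≠ 0 := fun h0 => hfree x ⟨by linarith, by linarith⟩ (by simp [h0])
  have hspl : (p.map (algebraMap ℝ ℂ)).Splits := IsAlgClosed.splits _
  set q := p.map (algebraMap ℝ ℂ) with hq
  have heval : ∀ y : ℝ, |p.eval y| =
      ‖q.leadingCoeff‖ * (q.roots.map (fun r => ‖(y : ℂ) - r‖)).prod := by
    intro y
    have h1 : q.eval (y : ℂ) = ((p.eval y : ℝ) : ℂ) := by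
      rw [hq, eval_map_algebraMap]
      exact aeval_algebraMap_apply (A := ℝ) ℂ y p
    rw [← Real.norm_eq_abs, ← Complex.norm_real, ← h1, hspl.eval_eq_prod_roots, norm_mul]
    congr 1
    exact (Multiset.prod_hom _ (normHom : ℂ →*₀ ℝ)).symm.trans (by simp [Multiset.map_map])
  have hroots : ∀ r ∈ q.roots,
      ‖((x - h : ℝ) : ℂ) - r‖ * ‖((x + h : ℝ) : ℂ) - r‖ ≤ ‖(x : ℂ) - r‖ * ‖(x : ℂ) - r‖ := by
    intro r hr
    have hr0 : aeval r p = 0 := by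
      rw [← eval_map_algebraMap]; exact (mem_roots'.1 hr).2
    have him := hp r hr0
    obtain ⟨s, rfl⟩ : ∃ s : ℝ, (s : ℂ) = r := ⟨r.re, by apply Complex.ext <;> simp [him]⟩
    have hs : p.eval s = 0 := by
      have : ((p.eval s : ℝ) : ℂ) = 0 := by rw [← hr0]; exact (aeval_algebraMap_apply ℂ s p).symm
      exact_mod_cast this
    have hnot : ¬ (x - h ≤ s ∧ s ≤ x + h) := fun hmem => hfree s hmem hs
    rw [← Complex.ofReal_sub, ← Complex.ofReal_sub, ← Complex.ofReal_sub]
    simp only [Complex.norm_real, Real.norm_eq_abs]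
    rw [← abs_mul, abs_mul_abs_self, abs_le]
    -- For a root outside the interval, the product of the end factors is `(x - s)² - h²`, which is
    -- nonnegative.
    have : h ^ 2 ≤ (x - s) ^ 2 := by
      rcases not_and_or.1 hnot with h1 | h1 <;> nlinarith
    constructor <;> nlinarith
  rw [← sq_abs (p.eval x), heval, heval, heval]
  have hprod := Multiset.prod_map_le_prod_map₀ (s := q.roots)
    (fun r => ‖((x - h : ℝ) : ℂ) - r‖ * ‖((x + h : ℝ) : ℂ) - r‖)
    (fun r => ‖(x : ℂ) - r‖ * ‖(x : ℂ) - r‖) (fun r _ => by positivity) hroots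
  rw [Multiset.prod_map_mul, Multiset.prod_map_mul] at hprod
  have := mul_le_mul_of_nonneg_left hprod (sq_nonneg ‖q.leadingCoeff‖)
  linarith

/-- Here `μ` and `-ν` are the roots of `λ² - Aλ - B`; the closed forms below use them. -/
theorem exists_pos_sub_eq_mul_eq (A : ℝ) {B : ℝ} (hB : 0 < B) :
    ∃ μ ν : ℝ, 0 < μ ∧ 0 < ν ∧ μ - ν = A ∧ μ * ν = B := by
  have hsq : √(A ^ 2 + 4 * B) ^ 2 = A ^ 2 + 4 * B := Real.sq_sqrt (by positivity)
  have habs : |A| < √(A ^ 2 + 4 * B) := by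
    rw [← Real.sqrt_sq_eq_abs]
    exact Real.sqrt_lt_sqrt (sq_nonneg A) (by linarith)
  rw [abs_lt] at habs
  refine ⟨(√(A ^ 2 + 4 * B) + A) / 2, (√(A ^ 2 + 4 * B) - A) / 2, by linarith, by linarith,
    by ring, by linear_combination hsq / 4⟩

theorem eval_linRecPoly_closed_form {a b c d x μ ν : ℝ} (hA : μ - ν = a * x + b)
    (hB : μ * ν = c * x + d) (n : ℕ) :
    (μ + ν) * (linRecPoly a b c d n).eval x = (x + ν) * μ ^ n + (μ - x) * (-ν) ^ n := by
  induction n using Nat.twoStepInduction with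
  | zero => simp [linRecPoly]; ring
  | one => simp [linRecPoly]; ring
  | more n h0 h1 =>
    rw [eval_linRecPoly_add_two, ← hA, ← hB]
    linear_combination (μ - ν) * h1 + μ * ν * h0

theorem eval_linRecPoly_even {a b c d x μ ν : ℝ} (hA : μ - ν = a * x + b)
    (hB : μ * ν = c * x + d) (k : ℕ) :
    (μ + ν) * (linRecPoly a b c d (2 * k)).eval x
      = (x + ν) * μ ^ (2 * k) + (μ - x) * ν ^ (2 * k) := by
  rw [eval_linRecPoly_closed_form hA hB, (even_two_mul k).neg_pow]

theorem eval_linRecPoly_odd {a b c d x μ ν : ℝ} (hA : μ - ν = a * x + b)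
    (hB : μ * ν = c * x + d) (k : ℕ) :
    (μ + ν) * (linRecPoly a b c d (2 * k + 1)).eval x
      = (x + ν) * μ ^ (2 * k + 1) + (x - μ) * ν ^ (2 * k + 1) := by
  rw [eval_linRecPoly_closed_form hA hB, (odd_two_mul_add_one k).neg_pow]
  ring

theorem exists_mul_pow_le_eval_linRecPoly {a b c d x μ : ℝ} (hx : 0 < x) (hA : 0 ≤ a * x + b)
    (hB : 0 ≤ c * x + d) (hμ : 0 < μ) (hμ2 : μ ^ 2 = (a * x + b) * μ + (c * x + d)) :
    ∃ C : ℝ, 0 < C ∧ ∀ n, C * μ ^ n ≤ (linRecPoly a b c d n).eval x := by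
  refine ⟨min 1 (x / μ), lt_min one_pos (div_pos hx hμ), fun n => ?_⟩
  induction n using Nat.twoStepInduction with
  | zero => simp [linRecPoly]
  | one =>
    simpa [linRecPoly] using (le_div_iff₀ hμ).1 (min_le_right 1 (x / μ))
  | more n h0 h1 =>
    rw [eval_linRecPoly_add_two]
    calc min 1 (x / μ) * μ ^ (n + 2)
        = (a * x + b) * (min 1 (x / μ) * μ ^ (n + 1))
          + (c * x + d) * (min 1 (x / μ) * μ ^ n) := by
          rw [pow_add, hμ2]; ring
      _ ≤ _ := by gcongr

theorem eval_linRecPoly_of_root {a b c d x : ℝ} (hA : a * x + b = 0) (ε k : ℕ) :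
    (linRecPoly a b c d (2 * k + ε)).eval x
      = (c * x + d) ^ k * (linRecPoly a b c d ε).eval x := by
  induction k with
  | zero => simp
  | succ k ih =>
    rw [show 2 * (k + 1) + ε = (2 * k + ε) + 2 by ring, eval_linRecPoly_add_two, hA, ih]
    ring

/-- A nonzero polynomial has constant sign immediately to the left of any point. -/
theorem exists_left_constant_sign {p : ℝ[X]} (hp : p ≠ 0) (x : ℝ) :
    ∃ δ > 0, (∀ y ∈ Set.Ico (x - δ) x, 0 < p.eval y) ∨ (∀ y ∈ Set.Ico (x - δ) x, p.eval y < 0) := by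
  have hfin : ((p.roots.toFinset : Set ℝ) \ {x}).Finite := (Finset.finite_toSet _).sdiff
  have hev : ∀ᶠ y in nhds x, y ∉ ((p.roots.toFinset : Set ℝ) \ {x}) :=
    hfin.isClosed.isOpen_compl.mem_nhds (by simp)
  obtain ⟨ε, hε, hball⟩ := Metric.eventually_nhds_iff.1 hev
  have hne : ∀ y ∈ Set.Ico (x - ε / 2) x, p.eval y ≠ 0 := by
    intro y hy h0
    refine hball (y := y) ?_ ⟨by simp [hp, h0], hy.2.ne⟩
    rw [Real.dist_eq, abs_lt]
    constructor <;> linarith [hy.1, hy.2]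
  refine ⟨ε / 2, by positivity, ?_⟩
  by_contra hcon
  push Not at hcon
  obtain ⟨⟨y, hy, hy0⟩, ⟨w, hw, hw0⟩⟩ := hcon
  obtain ⟨v, hv, hv0⟩ := (isPreconnected_Ico (a := x - ε / 2) (b := x)).intermediate_value hy hw
    p.continuous.continuousOn ⟨hy0, hw0⟩
  exact hne v hv hv0

theorem le_of_forall_realRooted {a b c d : ℝ} (ha : 0 < a) (hc : 0 < c) (hd : d < 0)
    (hW : ∀ n, RealRooted (linRecPoly a b c d n)) : a * d ≤ b * c := by
  by_contra! hlt
  obtain ⟨x, hx⟩ : ∃ x, x = -b / a := ⟨_, rfl⟩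
  have hAx : a * x + b = 0 := by rw [hx]; field_simp; simp
  have hB0 : 0 < c * x + d := by
    have : 0 < (c * x + d) * a := by
      rw [hx]; field_simp; linarith
    exact pos_of_mul_pos_left this ha.le
  set B := c * x + d with hB
  -- the sign of the characteristic polynomial at `x`
  set g : ℝ[X] := X ^ 2 - (C a * X + C b) * X - (C c * X + C d) with hg
  have hgeval : ∀ y, g.eval y = y ^ 2 - (a * y + b) * y - (c * y + d) := by intro y; simp [hg]
  have hg0 : g ≠ 0 := by
    intro h0
    have := hgeval 0
    rw [h0] at this
    simp at this
    exact hd.ne this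
  obtain ⟨δ, hδ, hsign⟩ := exists_left_constant_sign hg0 x
  set s := √B with hs
  have hs0 : 0 < s := Real.sqrt_pos.2 hB0
  have hs2 : s ^ 2 = B := Real.sq_sqrt hB0.le
  -- The last bound makes the first-order gain `aμ(B - ch)h` in `(μν)²` exceed the second-order loss
  -- `c²h²`.
  obtain ⟨h, hh, h1, h2, h3⟩ : ∃ h : ℝ,
      0 < h ∧ h ≤ δ ∧ c * h ≤ B / 2 ∧ c ^ 2 * h < a * (s * (B / 2)) := by
    have e : ∀ᶠ h in nhdsWithin (0 : ℝ) (Set.Ioi 0), c ^ 2 * h < a * (s * (B / 2)) := by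
      have : Filter.Tendsto (fun h : ℝ => c ^ 2 * h) (nhdsWithin 0 (Set.Ioi 0)) (nhds (c ^ 2 * 0)) :=
        (Continuous.tendsto (by fun_prop) 0).mono_left nhdsWithin_le_nhds
      exact this.eventually (gt_mem_nhds (by simp; positivity))
    have e2 : ∀ᶠ h in nhdsWithin (0 : ℝ) (Set.Ioi 0), c * h < B / 2 := by
      have : Filter.Tendsto (fun h : ℝ => c * h) (nhdsWithin 0 (Set.Ioi 0)) (nhds (c * 0)) :=
        (Continuous.tendsto (by fun_prop) 0).mono_left nhdsWithin_le_nhds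
      exact this.eventually (gt_mem_nhds (by simp; positivity))
    have e3 : ∀ᶠ h in nhdsWithin (0 : ℝ) (Set.Ioi 0), h < δ :=
      nhdsWithin_le_nhds (gt_mem_nhds hδ)
    obtain ⟨h, ⟨⟨k1, k2⟩, k3⟩, k4⟩ := (((e.and e2).and e3).and self_mem_nhdsWithin).exists
    exact ⟨h, k4, k3.le, k2.le, k1⟩
  have hBpos : ∀ y, x - h ≤ y → 0 < c * y + d := by
    intro y hy
    nlinarith
  have hypos : ∀ y, x - h ≤ y → 0 < y := by
    intro y hy
    have := hBpos y hy
    have : 0 < c * y := by linarith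
    exact pos_of_mul_pos_right this hc.le
  -- growth at the right end point
  obtain ⟨μ, μ', hμ, hμ', hμA, hμB⟩ := exists_pos_sub_eq_mul_eq (a * (x + h) + b)
    (hBpos (x + h) (by linarith))
  have hμ2 : μ ^ 2 = (a * (x + h) + b) * μ + (c * (x + h) + d) := by rw [← hμA, ← hμB]; ring
  -- growth at the left end point
  obtain ⟨ν', ν, hν', hν, hνA, hνB⟩ := exists_pos_sub_eq_mul_eq (a * (x - h) + b)
    (hBpos (x - h) le_rfl)
  have hν2 : ν ^ 2 = -(a * (x - h) + b) * ν + (c * (x - h) + d) := by rw [← hνA, ← hνB]; ring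
  have hgrow : B < μ * ν := by
    have hμ3 : μ ^ 2 = a * h * μ + (B + c * h) := by rw [hμ2, hB]; linear_combination μ * hAx
    have hν3 : ν ^ 2 = a * h * ν + (B - c * h) := by rw [hν2, hB]; linear_combination -ν * hAx
    have hsμ : s ≤ μ := by
      apply le_of_sq_le_sq _ hμ.le
      rw [hs2, hμ3]
      have : 0 < a * h * μ := by positivity
      have : 0 < c * h := by positivity
      linarith
    have key : s * (B / 2) ≤ μ * (B - c * h) := by
      apply mul_le_mul hsμ (by linarith) (by positivity) hμ.le
    have hBB : B ^ 2 < (μ * ν) ^ 2 := by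
      rw [mul_pow, hμ3, hν3]
      have k1 : c ^ 2 * h * h < a * (μ * (B - c * h)) * h := by
        apply mul_lt_mul_of_pos_right _ hh
        exact h3.trans_le (mul_le_mul_of_nonneg_left key ha.le)
      have k2 : 0 < a * h * ν * (a * h * μ + (B + c * h)) := by positivity
      nlinarith
    exact lt_of_pow_lt_pow_left₀ 2 (by positivity) hBB
  obtain ⟨C₁, hC₁, hgr⟩ := exists_mul_pow_le_eval_linRecPoly (a := a) (b := b) (c := c) (d := d)
    (hypos (x + h) (by linarith)) (by nlinarith) (hBpos (x + h) (by linarith)).le hμ hμ2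
  have hpos : ∀ n y, x ≤ y → 0 < (linRecPoly a b c d n).eval y := by
    intro n y hy
    obtain ⟨m, m', hm, hm', hmA, hmB⟩ := exists_pos_sub_eq_mul_eq (a * y + b)
      (hBpos y (by linarith))
    obtain ⟨C, hC, hle⟩ := exists_mul_pow_le_eval_linRecPoly (a := a) (b := b) (c := c) (d := d)
      (hypos y (by linarith)) (by nlinarith) (hBpos y (by linarith)).le hm
      (by rw [← hmA, ← hmB]; ring)
    exact (by positivity : 0 < C * m ^ n).trans_le (hle n)
  -- choice of parity
  obtain ⟨ε, hleft, C₂, hC₂, hgl⟩ : ∃ ε : ℕ,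
      (∀ k, ∀ y ∈ Set.Icc (x - h) x, 0 < (linRecPoly a b c d (2 * k + ε)).eval y) ∧
      ∃ C₂ : ℝ, 0 < C₂ ∧ ∀ k, C₂ * ν ^ (2 * k) ≤ (linRecPoly a b c d (2 * k + ε)).eval (x - h) := by
    -- The sign of `g` thus decides whether `y > m` or `y < m`, that is, whether the odd or the even
    -- closed form has two positive terms.
    have hfactor : ∀ {y m r : ℝ}, m - r = a * y + b → m * r = c * y + d →
        g.eval y = (y - m) * (y + r) := by
      intro y m r hmA hmB
      rw [hgeval, ← hmA, ← hmB]; ring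
    have hx1 : 0 < x - h := hypos _ le_rfl
    have hmem : x - h ∈ Set.Ico (x - δ) x := ⟨by linarith, by linarith⟩
    rcases hsign with hsign | hsign
    · have hlt : ∀ {y m r : ℝ}, 0 < r → m - r = a * y + b → m * r = c * y + d → x - h ≤ y →
          y < x → m < y := by
        intro y m r hr hmA hmB hy1 hy2
        have := hsign y ⟨by linarith, hy2⟩
        rw [hfactor hmA hmB] at this
        exact sub_pos.1 (pos_of_mul_pos_left this (by linarith [hypos y hy1]))
      refine ⟨1, fun k y hy => ?_, (x - h - ν') * ν / (ν' + ν), ?_, fun k => ?_⟩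
      · rcases hy.2.eq_or_lt with rfl | hyx
        · exact hpos _ _ le_rfl
        obtain ⟨m, r, hm, hr, hmA, hmB⟩ := exists_pos_sub_eq_mul_eq (a * y + b) (hBpos y hy.1)
        have hy0 := hypos y hy.1
        have hcf := eval_linRecPoly_odd hmA hmB k
        have := sub_pos.2 (hlt hr hmA hmB hy.1 hyx)
        refine pos_of_mul_pos_right (a := m + r) ?_ (by positivity)
        rw [hcf]; positivity
      · have := sub_pos.2 (hlt hν hνA hνB le_rfl hmem.2)
        positivity
      · have hcf := eval_linRecPoly_odd hνA hνB k
        rw [div_mul_eq_mul_div, div_le_iff₀' (by positivity), hcf]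
        have : 0 ≤ (x - h + ν) * ν' ^ (2 * k + 1) := by positivity
        rw [pow_succ ν]
        linarith
    · have hlt : ∀ {y m r : ℝ}, 0 < r → m - r = a * y + b → m * r = c * y + d → x - h ≤ y →
          y < x → y < m := by
        intro y m r hr hmA hmB hy1 hy2
        have := hsign y ⟨by linarith, hy2⟩
        rw [hfactor hmA hmB] at this
        exact sub_neg.1 (neg_of_mul_neg_left this (by linarith [hypos y hy1]))
      refine ⟨0, fun k y hy => ?_, (ν' - (x - h)) / (ν' + ν), ?_, fun k => ?_⟩
      · rcases hy.2.eq_or_lt with rfl | hyx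
        · exact hpos _ _ le_rfl
        obtain ⟨m, r, hm, hr, hmA, hmB⟩ := exists_pos_sub_eq_mul_eq (a * y + b) (hBpos y hy.1)
        have hy0 := hypos y hy.1
        have hcf := eval_linRecPoly_even hmA hmB k
        have := sub_pos.2 (hlt hr hmA hmB hy.1 hyx)
        refine pos_of_mul_pos_right (a := m + r) ?_ (by positivity)
        rw [add_zero, hcf]; positivity
      · have := sub_pos.2 (hlt hν hνA hνB le_rfl hmem.2)
        positivity
      · have hcf := eval_linRecPoly_even hνA hνB k
        rw [div_mul_eq_mul_div, div_le_iff₀' (by positivity), add_zero, hcf]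
        have : 0 ≤ (x - h + ν) * ν' ^ (2 * k) := by positivity
        linarith
  set w := (linRecPoly a b c d ε).eval x with hw
  -- The midpoint inequality for `W_{2k+ε}`, whose value at `x` is exactly `B^k w`.
  have hfinal : ∀ k : ℕ, C₂ * C₁ * μ ^ ε * ((μ * ν) ^ 2 / B ^ 2) ^ k ≤ w ^ 2 := by
    intro k
    have hlc := (hW (2 * k + ε)).abs_eval_mul_le (x := x) hh.le (by
      intro y hy
      rcases le_total y x with hyx | hyx
      · exact (hleft k y ⟨hy.1, hyx⟩).ne'
      · exact (hpos _ y hyx).ne')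
    rw [eval_linRecPoly_of_root hAx] at hlc
    have m1 := (hgl k).trans (le_abs_self _)
    have m2 := (hgr (2 * k + ε)).trans (le_abs_self _)
    have m3 := (mul_le_mul m1 m2 (by positivity) (abs_nonneg _)).trans hlc
    rw [div_pow, ← mul_div_assoc, div_le_iff₀ (by positivity)]
    calc _ = C₂ * ν ^ (2 * k) * (C₁ * μ ^ (2 * k + ε)) := by ring
      _ ≤ _ := m3
      _ = w ^ 2 * (B ^ 2) ^ k := by rw [← hB, ← hw, mul_pow, pow_right_comm]; exact mul_comm _ _
  have hratio : 1 < (μ * ν) ^ 2 / B ^ 2 := by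
    rw [one_lt_div (by positivity)]
    gcongr
  have htend := (tendsto_pow_atTop_atTop_of_one_lt hratio).const_mul_atTop
    (by positivity : 0 < C₂ * C₁ * μ ^ ε)
  obtain ⟨k, hk⟩ := (htend.eventually_gt_atTop (w ^ 2)).exists
  exact absurd (hfinal k) (not_le.2 hk)

theorem mainTheorem2 (a b c d : ℝ) (ha : 0 < a) (hb : b < 0) (hc : 0 < c) (hd : d < 0) :
    ((∀ n : ℕ, RealRooted (linRecPoly a b c d n)) ↔ xA a b ≤ xB c d) ∧
      (xA a b ≤ xB c d ↔ a * d ≤ b * c) := by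
  have h : xA a b ≤ xB c d ↔ a * d ≤ b * c := by
    rw [xA, xB, div_le_div_iff₀ ha hc]
    constructor <;> intro h <;> linarith
  exact ⟨⟨fun hW => h.2 (le_of_forall_realRooted ha hc hd hW),
    fun hx n => realRooted_linRecPoly ha hc hd (h.1 hx) n⟩, h⟩
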